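/- Every irrational $x\in[0,1]$ has a unique continued fraction expansion $x=[0,n_1,n_2,\dots]$ with partial quotients $n_i\in\mathbf Z_{>0}$. Define $$\mathbf J(x)=[0,1_{n_1-1},2,1_{n_2-2},2,1_{n_3-2},2,\dots],$$ where $1_k$ with $k\ge 1$ denotes a run of $k$ ones, and the symbols $1_0$ and $1_{-1}$ are eliminated one at a time by the rules $[\dots,m,1_0,n,\dots]\to[\dots,m,n,\dots]$ and $[\dots,m,1_{-1},n,\dots]\to[\dots,m+n-1,\dots]$; that is, $\mathbf J(x)$ is the limit of the values of the finite continued fractions obtained by reducing the words $0,1_{n_1-1},2,1_{n_2-2},2,\dots,1_{n_r-2},2$ as $r\to\infty$. Let $\mathcal A$ be the set of irrational $x=[0,n_1,n_2,\dots]\in[0,1]$ with $\lim_{k\to\infty}\frac{n_1+\cdots+n_k}{k}=\infty$. Let $X$ be a random variable uniformly distributed in $[0,1]$. Then: 1. Almost surely, $\mathbf J(X)=[0,m_1,m_2,\dots]$ is irrational and the frequency of $1$ among its partial quotients equals $1$, i.e. $\frac1N\,\#\{1\le j\le N: m_j=1\}\to 1$ as $N\to\infty$. 2. Almost surely, $\frac{m_1+\cdots+m_N}{N}\to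 1$ as $N\to\infty$. 3. The set $\mathcal A$ has full Lebesgue measure in $[0,1]$, and $\mathbf J(\mathcal A)$ has Lebesgue measure zero. -/

import Mathlib

open MeasureTheory Filter Topology

noncomputable section

/-- The `i`-th partial quotient `n_i` of the simple continued fraction `x = [n_0, n_1, n_2, …]`.
The value is `0` past the end of the (finite) expansion of a rational `x`. -/
def partialQuotient (x : ℝ) (i : ℕ) : ℤ :=
  ((GenContFract.IntFractPair.stream x i).map GenContFract.IntFractPair.b).getD 0

/-- The arithmetic mean `(n_1 + ⋯ + n_k) / k` of the partial quotients of `x`. -/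
def partialQuotientAverage (x : ℝ) (k : ℕ) : ℝ :=
  (∑ i ∈ Finset.Icc 1 k, (partialQuotient x i : ℝ)) / k

/-- The proportion of `1`s among the partial quotients `n_1, …, n_k` of `x`. -/
def onesProportion (x : ℝ) (k : ℕ) : ℝ :=
  (((Finset.Icc 1 k).filter fun i => partialQuotient x i = 1).card : ℝ) / k

end

/-- The formal word `m, 1_{k₁}, m₁, 1_{k₂}, m₂, …, 1_{kᵣ}, mᵣ` is represented by its first letter
`m` and the list `[(k₁, m₁), …, (kᵣ, mᵣ)]`, where each `kᵢ ≥ -1`. This is the list of partial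
quotients which it stands for: `1_k` is a run of `k` ones for `k ≥ 1`, `m, 1_0, n` becomes `m, n`,
and `m, 1_{-1}, n` becomes `m + n - 1`. -/
def reduceWord (m : ℤ) : List (ℤ × ℤ) → List ℤ
  | [] => [m]
  | (k, n) :: w =>
    if k = -1 then reduceWord (m + n - 1) w
    else m :: (List.replicate k.toNat 1 ++ reduceWord n w)

/-- For a sequence `n 1, n 2, …`, the reduction of the word
`0, 1_{n 1 - 1}, 2, 1_{n 2 - 2}, 2, …, 1_{n r - 2}, 2`. -/
def jimmWord (n : ℕ → ℤ) (r : ℕ) : List ℤ :=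
  reduceWord 0 ((List.range r).map fun i => (n (i + 1) - (if i = 0 then 1 else 2), 2))

noncomputable section

/-- The value of a finite continued fraction `[a₀, a₁, …, aᵣ] = a₀ + 1 / (a₁ + 1 / (⋯ + 1 / aᵣ))`
(for a one-letter list this is `a₀`, because `0⁻¹ = 0`). -/
def contFracValue : List ℤ → ℝ
  | [] => 0
  | a :: l => a + (contFracValue l)⁻¹

/-- The involution `J` (jimm) at an irrational `x = [0, n_1, n_2, …]` of the unit interval: the
value `[0, 1_{n_1 - 1}, 2, 1_{n_2 - 2}, 2, 1_{n_3 - 2}, …]`, i.e. the limit of the values of its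
reduced finite initial words. When `n_i = 1` for all large `i`, the last letter of these words
tends to infinity and the limit is the rational number given by the letters before it. -/
def jimm (x : ℝ) : ℝ :=
  limUnder atTop fun r : ℕ => contFracValue (jimmWord (partialQuotient x) r)

/-- The set `𝒜` of the (irrational) numbers in the unit interval whose partial quotient averages
tend to infinity. -/
def infiniteAverageSet : Set ℝ :=
  {x | x ∈ Set.Icc (0 : ℝ) 1 ∧ Irrational x ∧ Tendsto (partialQuotientAverage x) atTop atTop}

end

/-!
The statement rests on two facts.

*Metric part.* For almost every `x` the averages of the partial quotients tend to infinity.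
Conditionally on its first `k` partial quotients, the `k`-th iterate of a uniform `x` under the
Gauss map has density `gaussDensity q` for some `q ∈ [0, 1]`, and under each of these densities the
first partial quotient is at least `j` with probability `digitTail q j ≥ 1 / j`. An exponential
moment estimate (`tsum_digitWeight_le`, iterated in `setLIntegral_digitProd_le`) and the
Borel–Cantelli lemma show that almost surely, for each `j`, eventually at least `k / (4 j)` of
`n_1, …, n_k` are `≥ j`. As `n = ∑_{j ≥ 1} [j ≤ n]`, summing over `j ≤ M` bounds the averages
eventually from below by a quarter of the `M`-th harmonic number. No ergodic theorem is needed.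

*Combinatorial part.* If the word of `jimm x` is cut off after `n_r`, its reduction
has letter sum `n_1 + ⋯ + n_r + 1` and, not counting the leading `0`, `n_1 + ⋯ + n_r - r + 1`
letters, of which only the last one changes when the word is prolonged. So an initial
segment of `N ≤ n_1 + ⋯ + n_r - r` stable letters has sum at most `N + O(r)`, and if the averages
of the `n_i` tend to infinity, then `r = o(N)` for a suitable choice of `r`. Thus for
`x ∈ infiniteAverageSet` the averages of the partial quotients of `jimm x` tend to `1`, which forces
the proportion of ones to tend to `1` (`jimm_of_mem_infiniteAverageSet`).

The image of `infiniteAverageSet` is null because it lies in `[0, 1]` and is disjoint from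
`infiniteAverageSet`, a set of full measure: averages cannot tend both to `1` and to infinity.
-/

open scoped ENNReal

/-! ### Partial quotients and the Gauss map -/

theorem partialQuotient_succ (x : ℝ) (h : Int.fract x ≠ 0) (i : ℕ) :
    partialQuotient x (i + 1) = partialQuotient (Int.fract x)⁻¹ i := by
  unfold partialQuotient
  rw [GenContFract.IntFractPair.stream_succ h]

theorem partialQuotient_zero (x : ℝ) : partialQuotient x 0 = ⌊x⌋ := by
  simp [partialQuotient, GenContFract.IntFractPair.stream_zero, GenContFract.IntFractPair.of]

theorem partialQuotient_fract (x : ℝ) (i : ℕ) :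
    partialQuotient (Int.fract x) (i + 1) = partialQuotient x (i + 1) := by
  by_cases h : Int.fract x = 0
  · have hx : x = ((⌊x⌋ : ℤ) : ℝ) := by linarith [Int.self_sub_floor x]
    have h1 := GenContFract.IntFractPair.stream_succ_of_int (K := ℝ) ⌊x⌋ i
    have h2 := GenContFract.IntFractPair.stream_succ_of_int (K := ℝ) 0 i
    rw [← hx] at h1
    rw [Int.cast_zero] at h2
    simp only [partialQuotient, h, h1, h2]
  · rw [partialQuotient_succ x h, partialQuotient_succ _ (by rwa [Int.fract_fract]),
      Int.fract_fract]

theorem fract_eq_self_of_mem_Ioo {x : ℝ} (hx : x ∈ Set.Ioo (0 : ℝ) 1) : Int.fract x = x :=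
  Int.fract_eq_self.2 ⟨hx.1.le, hx.2⟩

theorem partialQuotient_one {x : ℝ} (hx : x ∈ Set.Ioo (0 : ℝ) 1) :
    partialQuotient x 1 = ⌊x⁻¹⌋ := by
  have h := fract_eq_self_of_mem_Ioo hx
  rw [partialQuotient_succ x (by rw [h]; exact hx.1.ne'), h, partialQuotient_zero]

theorem partialQuotient_add_two {x : ℝ} (hx : x ∈ Set.Ioo (0 : ℝ) 1) (i : ℕ) :
    partialQuotient x (i + 2) = partialQuotient (Int.fract x⁻¹) (i + 1) := by
  have h := fract_eq_self_of_mem_Ioo hx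
  rw [partialQuotient_succ x (by rw [h]; exact hx.1.ne'), h, partialQuotient_fract]

theorem fract_inv_mem_Ioo {x : ℝ} (hx : Irrational x) :
    Int.fract x⁻¹ ∈ Set.Ioo (0 : ℝ) 1 := by
  refine ⟨lt_of_le_of_ne (Int.fract_nonneg _) fun h => ?_, Int.fract_lt_one _⟩
  have h0 : x⁻¹ = ⌊x⁻¹⌋ := by
    have := Int.self_sub_floor x⁻¹
    linarith
  exact (irrational_inv_iff.2 hx) ⟨⌊x⁻¹⌋, by rw [Rat.cast_intCast]; exact h0.symm⟩

theorem irrational_fract_inv {x : ℝ} (hx : Irrational x) : Irrational (Int.fract x⁻¹) := by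
  rw [← Int.self_sub_floor]
  exact (irrational_inv_iff.2 hx).sub_intCast _

theorem one_le_partialQuotient {x : ℝ} (hx : Irrational x) (hx' : x ∈ Set.Ioo (0 : ℝ) 1) (i : ℕ) :
    1 ≤ partialQuotient x (i + 1) := by
  induction i generalizing x with
  | zero =>
    rw [partialQuotient_one hx', Int.le_floor]
    exact_mod_cast (one_lt_inv₀ hx'.1).2 hx'.2 |>.le
  | succ i ih =>
    rw [partialQuotient_add_two hx']
    exact ih (irrational_fract_inv hx) (fract_inv_mem_Ioo hx)

theorem irrational_of_partialQuotient_ne_zero {x : ℝ} (h : ∀ i, partialQuotient x (i + 1) ≠ 0) :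
    Irrational x := by
  rintro ⟨q, hq⟩
  obtain ⟨n, hn⟩ := (GenContFract.terminates_iff_rat x).2 ⟨q, hq.symm⟩
  replace hn := GenContFract.of_terminatedAt_n_iff_succ_nth_intFractPair_stream_eq_none.1 hn
  apply h n
  simp [partialQuotient, hn]

/-! ### Transport of densities by the Gauss map -/

/-- The product `∏ g(n_i)` over the first `k` partial quotients `n_i` of `x ∈ (0, 1)`, written as a
recursion along the Gauss map `x ↦ {1 / x}`. -/
noncomputable def digitProd (g : ℤ → ℝ≥0∞) : ℕ → ℝ → ℝ≥0∞
  | 0, _ => 1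
  | k + 1, x => g ⌊x⁻¹⌋ * digitProd g k (Int.fract x⁻¹)

theorem measurable_digitProd (g : ℤ → ℝ≥0∞) (k : ℕ) : Measurable (digitProd g k) := by
  induction k with
  | zero => exact measurable_const
  | succ k ih =>
    exact ((measurable_of_countable g).comp (Int.measurable_floor.comp measurable_inv)).mul
      (ih.comp (measurable_fract.comp measurable_inv))

theorem digitProd_eq_prod (g : ℤ → ℝ≥0∞) (k : ℕ) {x : ℝ} (hx : Irrational x)
    (hx' : x ∈ Set.Ioo (0 : ℝ) 1) :
    digitProd g k x = ∏ i ∈ Finset.range k, g (partialQuotient x (i + 1)) := by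
  induction k generalizing x with
  | zero => simp [digitProd]
  | succ k ih =>
    rw [Finset.prod_range_succ', digitProd, ih (irrational_fract_inv hx) (fract_inv_mem_Ioo hx),
      partialQuotient_one hx', mul_comm]
    simp only [partialQuotient_add_two hx']

/-- Change of variables `x = 1 / (a + t)` along one inverse branch of the Gauss map. -/
theorem setLIntegral_branch (a : ℕ) (Φ : ℝ → ℝ≥0∞) :
    ∫⁻ x in Set.Ioc ((a + 2 : ℝ)⁻¹) ((a + 1 : ℝ)⁻¹), Φ x =
      ∫⁻ t in Set.Ico (0 : ℝ) 1, ENNReal.ofReal (((a + 1 + t) ^ 2)⁻¹) * Φ ((a + 1 + t)⁻¹) := by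
  have himg : (fun t : ℝ => (a + 1 + t)⁻¹) '' Set.Ico (0 : ℝ) 1 =
      Set.Ioc ((a + 2 : ℝ)⁻¹) ((a + 1 : ℝ)⁻¹) := by
    ext x
    constructor
    · rintro ⟨t, ⟨h0, h1⟩, rfl⟩
      exact ⟨inv_strictAnti₀ (by positivity) (by linarith), inv_anti₀ (by positivity) (by linarith)⟩
    · rintro ⟨h0, h1⟩
      have hx : 0 < x := lt_trans (by positivity) h0
      refine ⟨x⁻¹ - (a + 1), ⟨?_, ?_⟩, by simp⟩
      · have := (le_inv_comm₀ hx (by positivity)).1 h1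
        linarith
      · have := (inv_lt_comm₀ (by positivity) hx).1 h0
        linarith
  rw [← himg, lintegral_image_eq_lintegral_abs_deriv_mul (f' := fun t => -1 / (a + 1 + t) ^ 2)
    measurableSet_Ico]
  · refine setLIntegral_congr_fun measurableSet_Ico fun t ht => ?_
    simp only [abs_div, abs_neg, abs_one, one_div, abs_of_nonneg (sq_nonneg ((a : ℝ) + 1 + t))]
  · intro t ht
    have : (a + 1 + t : ℝ) ≠ 0 := by have := ht.1; positivity
    exact (((hasDerivAt_id t).const_add (a + 1 : ℝ)).inv this).hasDerivWithinAt
  · intro s hs t ht hst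
    simpa using hst

theorem setLIntegral_Ioc_eq_tsum (Φ : ℝ → ℝ≥0∞) :
    ∫⁻ x in Set.Ioc (0 : ℝ) 1, Φ x =
      ∑' a : ℕ, ∫⁻ x in Set.Ioc ((a + 2 : ℝ)⁻¹) ((a + 1 : ℝ)⁻¹), Φ x := by
  have hanti : Antitone fun a : ℕ => ((a + 1 : ℝ)⁻¹) := fun a b hab =>
    inv_anti₀ (by positivity) (by simpa using hab)
  have hU : Set.Ioc (0 : ℝ) 1 = ⋃ a : ℕ, Set.Ioc ((a + 2 : ℝ)⁻¹) ((a + 1 : ℝ)⁻¹) := by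
    ext x
    simp only [Set.mem_iUnion]
    constructor
    · rintro ⟨h0, h1⟩
      have h2 : 1 ≤ x⁻¹ := (one_le_inv₀ h0).2 h1
      obtain ⟨b, hb⟩ : ∃ b, ⌊x⁻¹⌋₊ = b + 1 :=
        Nat.exists_eq_succ_of_ne_zero (Nat.floor_pos.2 h2).ne'
      have h3 := Nat.floor_le (zero_le_one.trans h2)
      have h4 := Nat.lt_floor_add_one x⁻¹
      rw [hb] at h3 h4
      push_cast at h3 h4
      exact ⟨b, (inv_lt_comm₀ (by positivity) h0).2 (by linarith),
        (le_inv_comm₀ h0 (by positivity)).2 h3⟩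
    · rintro ⟨a, h0, h1⟩
      refine ⟨lt_trans (by positivity) h0, h1.trans ?_⟩
      exact inv_le_one_of_one_le₀ (by linarith [(Nat.cast_nonneg a : (0 : ℝ) ≤ a)])
  rw [hU, lintegral_iUnion (fun _ => measurableSet_Ioc)]
  have h := hanti.pairwise_disjoint_on_Ioc_succ
  simp only [Order.succ_eq_add_one] at h
  push_cast at h
  simpa only [add_assoc, one_add_one_eq_two] using h

/-- The density on `[0, 1]` of the `k`-th iterate of a uniform variable under the Gauss map,
conditionally on its first `k` partial quotients; `q` is the ratio of the last two denominators of
the convergents. The value `q = 0` gives the uniform density. -/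
noncomputable def gaussDensity (q x : ℝ) : ℝ := (1 + q) / (1 + q * x) ^ 2

/-- The probability that the first partial quotient is at least `a` (that is, that `x ≤ 1 / a`) under
the density `gaussDensity q`. -/
noncomputable def digitTail (q : ℝ) (a : ℕ) : ℝ := (1 + q) / (a + q)

theorem digitTail_anti {q : ℝ} (hq : 0 ≤ q) {a b : ℕ} (ha : 1 ≤ a) (hab : a ≤ b) :
    digitTail q b ≤ digitTail q a := by
  have h1 : (1 : ℝ) ≤ a := by exact_mod_cast ha
  have h2 : (a : ℝ) ≤ b := by exact_mod_cast hab
  unfold digitTail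
  gcongr

theorem inv_le_digitTail {q : ℝ} (hq : 0 ≤ q) {a : ℕ} (ha : 1 ≤ a) :
    (a : ℝ)⁻¹ ≤ digitTail q a := by
  have h1 : (1 : ℝ) ≤ a := by exact_mod_cast ha
  unfold digitTail
  rw [inv_eq_one_div, div_le_div_iff₀ (by positivity) (by positivity)]
  nlinarith

/-- The branch `t ↦ 1 / (a + 1 + t)` carries `gaussDensity q` to a density of the same family, times
the probability that the first partial quotient is `a + 1`. -/
theorem gaussDensity_branch {q t : ℝ} (hq : 0 ≤ q) (ht : 0 ≤ t) (a : ℕ) :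
    ((a + 1 + t) ^ 2)⁻¹ * gaussDensity q (a + 1 + t)⁻¹ =
      (digitTail q (a + 1) - digitTail q (a + 2)) * gaussDensity (a + 1 + q)⁻¹ t := by
  unfold gaussDensity digitTail
  push_cast
  have h1 : (a + 1 + t : ℝ) ≠ 0 := by positivity
  have h2 : (a + 1 + q : ℝ) ≠ 0 := by positivity
  have h3 : (a + 2 + q : ℝ) ≠ 0 := by positivity
  have h4 : (a + 1 + t + q : ℝ) ≠ 0 := by positivity
  have h5 : 1 + q * (a + 1 + t : ℝ)⁻¹ = (a + 1 + t + q) / (a + 1 + t) := by field_simp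
  have h6 : 1 + (a + 1 + q : ℝ)⁻¹ * t = (a + 1 + t + q) / (a + 1 + q) := by field_simp; ring
  have h7 : 1 + (a + 1 + q : ℝ)⁻¹ = (a + 2 + q) / (a + 1 + q) := by field_simp; ring
  rw [h5, h6, h7]
  field_simp
  ring

theorem setLIntegral_digitProd_succ (g : ℤ → ℝ≥0∞) (k : ℕ) {q : ℝ} (hq : 0 ≤ q) :
    ∫⁻ x in Set.Ioc (0 : ℝ) 1, ENNReal.ofReal (gaussDensity q x) * digitProd g (k + 1) x =
      ∑' a : ℕ, ENNReal.ofReal (digitTail q (a + 1) - digitTail q (a + 2)) * g (a + 1) *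
        ∫⁻ t in Set.Ioc (0 : ℝ) 1,
          ENNReal.ofReal (gaussDensity (a + 1 + q)⁻¹ t) * digitProd g k t := by
  rw [setLIntegral_Ioc_eq_tsum]
  congr 1 with a
  have hm : Measurable fun t : ℝ =>
      ENNReal.ofReal (gaussDensity (a + 1 + q)⁻¹ t) * digitProd g k t := by
    refine Measurable.mul ?_ (measurable_digitProd g k)
    unfold gaussDensity
    fun_prop
  rw [setLIntegral_branch, ← setLIntegral_congr Ico_ae_eq_Ioc, ← lintegral_const_mul _ hm]
  refine setLIntegral_congr_fun measurableSet_Ico fun t ht => ?_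
  have hfl : ⌊(a + 1 + t : ℝ)⌋ = a + 1 := by
    rw [Int.floor_eq_iff]
    push_cast
    exact ⟨by linarith [ht.1], by linarith [ht.2]⟩
  have hfr : Int.fract (a + 1 + t : ℝ) = t := by
    rw [← Int.self_sub_floor, hfl]
    push_cast
    ring
  have hp : 0 ≤ digitTail q (a + 1) - digitTail q (a + 2) :=
    sub_nonneg.2 (digitTail_anti hq (by omega) (by omega))
  have h2 : 0 ≤ (((a : ℝ) + 1 + t) ^ 2)⁻¹ := by positivity
  simp only [digitProd, inv_inv, hfl, hfr]
  rw [← mul_assoc, ← ENNReal.ofReal_mul h2, gaussDensity_branch hq ht.1, ENNReal.ofReal_mul hp]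
  ring

/-- If `g` of the first partial quotient has mean at most `ρ` under every density of the family, then
`∏ g(n_i)` over `k` partial quotients has mean `O(ρ ^ k)`. The factor `2` is a crude bound for the
total mass of `gaussDensity q`, which is in fact `1`. -/
theorem setLIntegral_digitProd_le (g : ℤ → ℝ≥0∞) (ρ : ℝ≥0∞)
    (hρ : ∀ q : ℝ, 0 ≤ q →
      ∑' a : ℕ, ENNReal.ofReal (digitTail q (a + 1) - digitTail q (a + 2)) * g (a + 1) ≤ ρ)
    (k : ℕ) {q : ℝ} (hq : 0 ≤ q) (hq1 : q ≤ 1) :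
    ∫⁻ x in Set.Ioc (0 : ℝ) 1, ENNReal.ofReal (gaussDensity q x) * digitProd g k x ≤
      2 * ρ ^ k := by
  induction k generalizing q with
  | zero =>
    calc _ ≤ ∫⁻ x in Set.Ioc (0 : ℝ) 1, 2 := by
          refine setLIntegral_mono measurable_const fun x hx => ?_
          have h1 : 1 ≤ (1 + q * x) ^ 2 := one_le_pow₀ (by nlinarith [hx.1])
          have h2 : gaussDensity q x ≤ 2 :=
            (div_le_self (by linarith) h1).trans (by linarith)
          simpa [digitProd] using ENNReal.ofReal_le_ofReal h2
      _ = 2 * ρ ^ 0 := by simp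
  | succ k ih =>
    rw [setLIntegral_digitProd_succ g k hq]
    calc _ ≤ ∑' a : ℕ, ENNReal.ofReal (digitTail q (a + 1) - digitTail q (a + 2)) * g (a + 1) *
          (2 * ρ ^ k) := by
          gcongr with a
          exact ih (by positivity)
            (inv_le_one_of_one_le₀ (by linarith [(Nat.cast_nonneg a : (0 : ℝ) ≤ a)]))
      _ = (∑' a : ℕ, ENNReal.ofReal (digitTail q (a + 1) - digitTail q (a + 2)) * g (a + 1)) *
          (2 * ρ ^ k) := ENNReal.tsum_mul_right
      _ ≤ ρ * (2 * ρ ^ k) := by gcongr; exact hρ q hq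
      _ = 2 * ρ ^ (k + 1) := by ring

/-! ### Almost every number has averages tending to infinity -/

/-- The weight `exp (1 / (4 j) - [j ≤ n])`. Its product over `n_1, …, n_k` is less than `1` exactly
when more than `k / (4 j)` of the `n_i` are at least `j`. -/
noncomputable def digitWeight (j : ℕ) (n : ℤ) : ℝ :=
  Real.exp ((4 * j : ℝ)⁻¹ - if (j : ℤ) ≤ n then 1 else 0)

/-- Since `j ≤ n` has probability at least `1 / j`, the mean of `digitWeight j` is at most
`exp (1 / (4 j)) * (1 - 1 / (2 j)) ≤ exp (-1 / (4 j))`. -/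
theorem tsum_digitWeight_le {j : ℕ} (hj : 1 ≤ j) {q : ℝ} (hq : 0 ≤ q) :
    ∑' a : ℕ, ENNReal.ofReal (digitTail q (a + 1) - digitTail q (a + 2)) *
      ENNReal.ofReal (digitWeight j (a + 1)) ≤ ENNReal.ofReal (Real.exp (-(4 * j : ℝ)⁻¹)) := by
  have hp : ∀ a : ℕ, 0 ≤ digitTail q (a + 1) - digitTail q (a + 2) := fun a =>
    sub_nonneg.2 (digitTail_anti hq (by omega) (by omega))
  have hκ0 : 0 ≤ 1 - Real.exp (-1) := by linarith [Real.exp_neg_one_lt_half]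
  -- Up to the factor `exp (1 / (4 j))`, `V a` is the part of the series from `a` on, so the partial
  -- sums telescope.
  set V : ℕ → ℝ := fun a => digitTail q a - (1 - Real.exp (-1)) * digitTail q (max a j) with hV
  have hV0 : ∀ a, 1 ≤ a → 0 ≤ V a := by
    intro a ha
    have h1 : digitTail q (max a j) ≤ digitTail q a := digitTail_anti hq ha (le_max_left _ _)
    have h2 : 0 ≤ digitTail q (max a j) := by unfold digitTail; positivity
    have h3 := Real.exp_pos (-1)
    simp only [hV]
    nlinarith
  have hterm : ∀ a : ℕ, (digitTail q (a + 1) - digitTail q (a + 2)) * digitWeight j (a + 1) =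
      Real.exp (4 * j : ℝ)⁻¹ * V (a + 1) - Real.exp (4 * j : ℝ)⁻¹ * V (a + 2) := by
    intro a
    simp only [hV, digitWeight]
    by_cases h : j ≤ a + 1
    · rw [if_pos (by exact_mod_cast h), max_eq_left h, max_eq_left (by omega), sub_eq_add_neg _ 1,
        Real.exp_add]
      ring
    · rw [if_neg (by exact_mod_cast h), max_eq_right (by omega), max_eq_right (by omega), sub_zero]
      ring
  refine ENNReal.tsum_le_of_sum_range_le fun N => ?_
  simp only [← ENNReal.ofReal_mul (hp _), hterm]
  rw [← ENNReal.ofReal_sum_of_nonneg fun a _ => by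
    rw [← hterm]; exact mul_nonneg (hp a) (Real.exp_pos _).le]
  refine ENNReal.ofReal_le_ofReal ?_
  rw [Finset.sum_range_sub' (fun a => Real.exp (4 * j : ℝ)⁻¹ * V (a + 1))]
  have hj0 : (0 : ℝ) < j := by exact_mod_cast hj
  have hV1 : V 1 ≤ Real.exp (-(2 * j : ℝ)⁻¹) := by
    have h1 : digitTail q 1 = 1 := by
      unfold digitTail
      rw [Nat.cast_one]
      exact div_self (by positivity)
    have h2 := inv_le_digitTail hq hj
    have h3 : (2 * j : ℝ)⁻¹ = 1 / 2 * (j : ℝ)⁻¹ := by rw [mul_inv]; norm_num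
    have h4 : (0 : ℝ) < (j : ℝ)⁻¹ := by positivity
    have h5 := Real.exp_neg_one_lt_half
    have h6 := Real.add_one_le_exp (-(2 * j : ℝ)⁻¹)
    simp only [hV, max_eq_right hj, h1]
    nlinarith
  calc Real.exp (4 * j : ℝ)⁻¹ * V (0 + 1) - Real.exp (4 * j : ℝ)⁻¹ * V (N + 1)
      ≤ Real.exp (4 * j : ℝ)⁻¹ * V 1 :=
        sub_le_self _ (mul_nonneg (Real.exp_pos _).le (hV0 _ (by omega)))
    _ ≤ Real.exp (4 * j : ℝ)⁻¹ * Real.exp (-(2 * j : ℝ)⁻¹) := by gcongr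
    _ = Real.exp (-(4 * j : ℝ)⁻¹) := by
        rw [← Real.exp_add]
        congr 1
        field_simp
        norm_num

theorem ae_eventually_digitProd_lt_one {j : ℕ} (hj : 1 ≤ j) :
    ∀ᵐ x ∂volume.restrict (Set.Ioc (0 : ℝ) 1), ∀ᶠ k in atTop,
      digitProd (fun n => ENNReal.ofReal (digitWeight j n)) k x < 1 := by
  set g : ℤ → ℝ≥0∞ := fun n => ENNReal.ofReal (digitWeight j n) with hg
  set ρ : ℝ≥0∞ := ENNReal.ofReal (Real.exp (-(4 * j : ℝ)⁻¹)) with hρ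
  have hj0 : (0 : ℝ) < j := by exact_mod_cast hj
  have hρ1 : ρ < 1 := by
    rw [hρ, ENNReal.ofReal_lt_one, Real.exp_lt_one_iff]
    have : 0 < (4 * j : ℝ)⁻¹ := by positivity
    linarith
  have hk : ∀ k, volume.restrict (Set.Ioc (0 : ℝ) 1) {x | 1 ≤ digitProd g k x} ≤ 2 * ρ ^ k := by
    intro k
    have h1 := mul_meas_ge_le_lintegral (μ := volume.restrict (Set.Ioc (0 : ℝ) 1))
      (measurable_digitProd g k) 1
    rw [one_mul] at h1
    -- The density with `q = 0` is the constant `1`.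
    have h2 := setLIntegral_digitProd_le g ρ (fun q hq => tsum_digitWeight_le hj hq) k
      le_rfl zero_le_one
    simp only [gaussDensity, add_zero, zero_mul, one_pow, div_one, ENNReal.ofReal_one,
      one_mul] at h2
    exact h1.trans h2
  have hsum : ∑' k, volume.restrict (Set.Ioc (0 : ℝ) 1) {x | 1 ≤ digitProd g k x} ≠ ∞ := by
    refine ne_top_of_le_ne_top ?_ (ENNReal.tsum_le_tsum hk)
    rw [ENNReal.tsum_mul_left, ENNReal.tsum_geometric]
    exact ENNReal.mul_ne_top (by simp) (ENNReal.inv_ne_top.2 (tsub_pos_of_lt hρ1).ne')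
  filter_upwards [ae_eventually_notMem hsum] with x hx
  filter_upwards [hx] with k hk
  exact not_le.1 hk

theorem lt_card_of_digitProd_lt_one {j k : ℕ} {x : ℝ} (hx : Irrational x)
    (hx' : x ∈ Set.Ioo (0 : ℝ) 1)
    (h : digitProd (fun n => ENNReal.ofReal (digitWeight j n)) k x < 1) :
    (4 * j : ℝ)⁻¹ * k <
      ∑ i ∈ Finset.Icc 1 k, if (j : ℤ) ≤ partialQuotient x i then (1 : ℝ) else 0 := by
  rw [digitProd_eq_prod _ _ hx hx'] at h
  simp only [digitWeight] at h
  rw [← ENNReal.ofReal_prod_of_nonneg fun _ _ => (Real.exp_pos _).le, ENNReal.ofReal_lt_one,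
    ← Real.exp_sum, Real.exp_lt_one_iff, Finset.sum_sub_distrib, Finset.sum_const,
    Finset.card_range, nsmul_eq_mul, sub_neg, mul_comm] at h
  rwa [Finset.range_eq_Ico, Finset.sum_Ico_add' (fun i => if (j : ℤ) ≤ partialQuotient x i then
    (1 : ℝ) else 0) 0 k 1, zero_add, Finset.Ico_add_one_right_eq_Icc] at h

theorem sum_indicator_le {n : ℤ} (hn : 0 ≤ n) (M : ℕ) :
    ∑ j ∈ Finset.range M, (if ((j + 1 : ℕ) : ℤ) ≤ n then (1 : ℝ) else 0) ≤ n := by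
  lift n to ℕ using hn
  rw [Finset.sum_boole]
  have : (Finset.range M).filter (fun j => ((j + 1 : ℕ) : ℤ) ≤ n) ⊆ Finset.range n := by
    intro j hj
    rw [Finset.mem_filter] at hj
    rw [Finset.mem_range]
    have := hj.2
    omega
  have := Finset.card_le_card this
  rw [Finset.card_range] at this
  exact_mod_cast this

theorem ae_tendsto_partialQuotientAverage :
    ∀ᵐ x ∂volume.restrict (Set.Ioc (0 : ℝ) 1),
      Tendsto (partialQuotientAverage x) atTop atTop := by
  have hirr : ∀ᵐ x ∂volume.restrict (Set.Ioc (0 : ℝ) 1), Irrational x := by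
    refine ae_restrict_of_ae ?_
    have := (Set.countable_range ((↑) : ℚ → ℝ)).ae_notMem volume
    exact this
  have hall := ae_all_iff.2 fun j : ℕ => ae_eventually_digitProd_lt_one (j := j + 1) (by omega)
  filter_upwards [hirr, hall, ae_restrict_mem measurableSet_Ioc] with x hx hev hmem
  have hx' : x ∈ Set.Ioo (0 : ℝ) 1 := ⟨hmem.1, lt_of_le_of_ne hmem.2 hx.ne_one⟩
  refine tendsto_atTop.2 fun C => ?_
  obtain ⟨M, hM⟩ :=
    (Real.tendsto_sum_range_one_div_nat_succ_atTop.eventually_ge_atTop (4 * C)).exists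
  have hev' : ∀ᶠ k in atTop, ∀ j ∈ Finset.range M,
      digitProd (fun n => ENNReal.ofReal (digitWeight (j + 1) n)) k x < 1 :=
    (Finset.eventually_all _).2 fun j _ => hev j
  filter_upwards [hev', eventually_gt_atTop 0] with k hk hk0
  have hk1 : (0 : ℝ) < k := by exact_mod_cast hk0
  rw [partialQuotientAverage, le_div_iff₀ hk1]
  calc C * k ≤ (∑ j ∈ Finset.range M, (4 * ((j + 1 : ℕ) : ℝ))⁻¹) * k := by
        gcongr
        have : ∑ j ∈ Finset.range M, (4 * ((j + 1 : ℕ) : ℝ))⁻¹ =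
            4⁻¹ * ∑ j ∈ Finset.range M, 1 / ((j : ℝ) + 1) := by
          rw [Finset.mul_sum]
          refine Finset.sum_congr rfl fun j _ => ?_
          push_cast
          rw [mul_inv, one_div]
        rw [this]
        linarith
    _ = ∑ j ∈ Finset.range M, (4 * ((j + 1 : ℕ) : ℝ))⁻¹ * k := Finset.sum_mul ..
    _ ≤ ∑ j ∈ Finset.range M, ∑ i ∈ Finset.Icc 1 k,
          (if ((j + 1 : ℕ) : ℤ) ≤ partialQuotient x i then (1 : ℝ) else 0) :=
        Finset.sum_le_sum fun j hj => (lt_card_of_digitProd_lt_one hx hx' (hk j hj)).le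
    _ = ∑ i ∈ Finset.Icc 1 k, ∑ j ∈ Finset.range M,
          (if ((j + 1 : ℕ) : ℤ) ≤ partialQuotient x i then (1 : ℝ) else 0) := Finset.sum_comm
    _ ≤ ∑ i ∈ Finset.Icc 1 k, (partialQuotient x i : ℝ) := by
        refine Finset.sum_le_sum fun i hi => sum_indicator_le ?_ M
        obtain ⟨i, rfl⟩ := Nat.exists_eq_succ_of_ne_zero
          (Nat.one_le_iff_ne_zero.1 (Finset.mem_Icc.1 hi).1)
        exact zero_le_one.trans (one_le_partialQuotient hx hx' i)

/-! ### Values of infinite continued fractions -/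

/-- `cfEval m N t = 1 / (m 0 + 1 / (m 1 + ⋯ + 1 / (m (N - 1) + t)))`, with `cfEval m 0 t = t`. -/
noncomputable def cfEval : (ℕ → ℤ) → ℕ → ℝ → ℝ
  | _, 0, t => t
  | m, N + 1, t => ((m 0 : ℝ) + cfEval (fun i => m (i + 1)) N t)⁻¹

theorem inv_add_mem_Icc {a : ℤ} (ha : 1 ≤ a) {t : ℝ} (ht : 0 ≤ t) :
    ((a : ℝ) + t)⁻¹ ∈ Set.Icc (0 : ℝ) 1 := by
  have : (1 : ℝ) ≤ a := by exact_mod_cast ha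
  exact ⟨by positivity, inv_le_one_of_one_le₀ (by linarith)⟩

theorem cfEval_mem_Icc {m : ℕ → ℤ} (hm : ∀ i, 1 ≤ m i) (N : ℕ) {t : ℝ}
    (ht : t ∈ Set.Icc (0 : ℝ) 1) : cfEval m N t ∈ Set.Icc (0 : ℝ) 1 := by
  induction N generalizing m with
  | zero => exact ht
  | succ N ih => exact inv_add_mem_Icc (hm 0) (ih fun i => hm (i + 1)).1

theorem abs_inv_add_inv_add_sub_le {a b s t : ℝ} (ha : 1 ≤ a) (hb : 1 ≤ b) (hs : 0 ≤ s)
    (ht : 0 ≤ t) : |(a + (b + s)⁻¹)⁻¹ - (a + (b + t)⁻¹)⁻¹| ≤ |s - t| / 4 := by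
  have h1 : 2 ≤ a * (b + s) + 1 := by nlinarith
  have h2 : 2 ≤ a * (b + t) + 1 := by nlinarith
  have h3 : (a + (b + s)⁻¹)⁻¹ - (a + (b + t)⁻¹)⁻¹ =
      (s - t) / ((a * (b + s) + 1) * (a * (b + t) + 1)) := by
    have h4 : a + (b + s)⁻¹ = (a * (b + s) + 1) / (b + s) := by field_simp
    have h5 : a + (b + t)⁻¹ = (a * (b + t) + 1) / (b + t) := by field_simp
    rw [h4, h5, inv_div, inv_div, div_sub_div _ _ (by positivity) (by positivity)]
    congr 1
    ring
  rw [h3, abs_div, abs_of_pos (a := (a * (b + s) + 1) * (a * (b + t) + 1)) (by positivity)]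
  gcongr
  nlinarith

/-- Two levels of the fraction contract distances by a factor `4`, and one level preserves
`[0, 1]`. -/
theorem abs_cfEval_sub_le {m : ℕ → ℤ} (hm : ∀ i, 1 ≤ m i) (N : ℕ) {s t : ℝ}
    (hs : s ∈ Set.Icc (0 : ℝ) 1) (ht : t ∈ Set.Icc (0 : ℝ) 1) :
    |cfEval m N s - cfEval m N t| ≤ 2 * (1 / 2) ^ N := by
  have h01 : ∀ N : ℕ, |cfEval m N s - cfEval m N t| ≤ 1 := fun N => by
    have h1 := cfEval_mem_Icc hm N hs
    have h2 := cfEval_mem_Icc hm N ht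
    rw [abs_le]
    constructor <;> linarith [h1.1, h1.2, h2.1, h2.2]
  induction N using Nat.twoStepInduction generalizing m with
  | zero => exact (h01 0).trans (by norm_num)
  | one => exact (h01 1).trans (by norm_num)
  | more N ih _ =>
    have hm' : ∀ i, 1 ≤ m (i + 1 + 1) := fun i => hm _
    have h1 := abs_inv_add_inv_add_sub_le (a := m 0) (b := m 1) (by exact_mod_cast hm 0)
      (by exact_mod_cast hm 1) (cfEval_mem_Icc hm' N hs).1 (cfEval_mem_Icc hm' N ht).1
    refine (h1.trans ?_ : |cfEval m (N + 2) s - cfEval m (N + 2) t| ≤ _)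
    have h2 := ih (m := fun i => m (i + 1 + 1)) hm' fun N => by
      have h1 := cfEval_mem_Icc hm' N hs
      have h2 := cfEval_mem_Icc hm' N ht
      rw [abs_le]
      constructor <;> linarith [h1.1, h1.2, h2.1, h2.2]
    rw [pow_add]
    linarith

theorem cfEval_succ (m : ℕ → ℤ) (N : ℕ) (t : ℝ) :
    cfEval m (N + 1) t = cfEval m N ((m N : ℝ) + t)⁻¹ := by
  induction N generalizing m with
  | zero => rfl
  | succ N ih =>
    rw [cfEval, ih]
    rfl

/-- The value of the infinite continued fraction `[0, m 0, m 1, …]`. -/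
noncomputable def cfLimit (m : ℕ → ℤ) : ℝ := limUnder atTop fun N => cfEval m N 0

theorem tendsto_cfEval_zero {m : ℕ → ℤ} (hm : ∀ i, 1 ≤ m i) :
    Tendsto (fun N => cfEval m N 0) atTop (𝓝 (cfLimit m)) := by
  refine CauchySeq.tendsto_limUnder (cauchySeq_of_le_geometric (1 / 2) 2 (by norm_num) fun N => ?_)
  rw [Real.dist_eq, cfEval_succ]
  exact abs_cfEval_sub_le hm N ⟨le_rfl, zero_le_one⟩ (inv_add_mem_Icc (hm N) le_rfl)

/-- Arbitrary tails in `[0, 1]` may be used; this covers finite words whose last letters still change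
as the words grow. -/
theorem tendsto_cfEval {m : ℕ → ℤ} (hm : ∀ i, 1 ≤ m i) {ι : Type*} {l : Filter ι} {N : ι → ℕ}
    (hN : Tendsto N l atTop) {t : ι → ℝ} (ht : ∀ i, t i ∈ Set.Icc (0 : ℝ) 1) :
    Tendsto (fun i => cfEval m (N i) (t i)) l (𝓝 (cfLimit m)) := by
  have h1 : Tendsto (fun i => (2 : ℝ) * (1 / 2) ^ N i) l (𝓝 0) := by
    have := (tendsto_pow_atTop_nhds_zero_of_lt_one (r := (1 / 2 : ℝ)) (by norm_num)
      (by norm_num)).const_mul 2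
    rw [mul_zero] at this
    exact this.comp hN
  have h2 : Tendsto (fun i => cfEval m (N i) (t i) - cfEval m (N i) 0) l (𝓝 0) :=
    squeeze_zero_norm (fun i => abs_cfEval_sub_le hm _ (ht i) ⟨le_rfl, zero_le_one⟩) h1
  simpa using h2.add ((tendsto_cfEval_zero hm).comp hN)

theorem cfLimit_mem_Icc {m : ℕ → ℤ} (hm : ∀ i, 1 ≤ m i) : cfLimit m ∈ Set.Icc (0 : ℝ) 1 :=
  isClosed_Icc.mem_of_tendsto (tendsto_cfEval_zero hm)
    (Eventually.of_forall fun N => cfEval_mem_Icc hm N ⟨le_rfl, zero_le_one⟩)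

theorem cfLimit_eq {m : ℕ → ℤ} (hm : ∀ i, 1 ≤ m i) :
    cfLimit m = ((m 0 : ℝ) + cfLimit fun i => m (i + 1))⁻¹ := by
  have hm' : ∀ i, 1 ≤ m (i + 1) := fun i => hm _
  have h0 : (1 : ℝ) ≤ m 0 := by exact_mod_cast hm 0
  refine tendsto_nhds_unique ((tendsto_add_atTop_iff_nat 1).2 (tendsto_cfEval_zero hm)) ?_
  refine ((tendsto_cfEval_zero hm').const_add (m 0 : ℝ)).inv₀ ?_
  linarith [(cfLimit_mem_Icc hm').1]

theorem cfLimit_mem_Ioo {m : ℕ → ℤ} (hm : ∀ i, 1 ≤ m i) : cfLimit m ∈ Set.Ioo (0 : ℝ) 1 := by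
  have hpos : ∀ {m : ℕ → ℤ}, (∀ i, 1 ≤ m i) → 0 < cfLimit m := fun {m} hm => by
    have h0 : (1 : ℝ) ≤ m 0 := by exact_mod_cast hm 0
    rw [cfLimit_eq hm, inv_pos]
    linarith [(cfLimit_mem_Icc fun i => hm (i + 1)).1]
  refine ⟨hpos hm, ?_⟩
  have h0 : (1 : ℝ) ≤ m 0 := by exact_mod_cast hm 0
  rw [cfLimit_eq hm]
  exact inv_lt_one_of_one_lt₀ (by linarith [hpos fun i => hm (i + 1)])

theorem partialQuotient_cfLimit {m : ℕ → ℤ} (hm : ∀ i, 1 ≤ m i) (i : ℕ) :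
    partialQuotient (cfLimit m) (i + 1) = m i := by
  have hmem := cfLimit_mem_Ioo hm
  have hmem' := cfLimit_mem_Ioo fun i => hm (i + 1)
  have hfl : ⌊(cfLimit m)⁻¹⌋ = m 0 := by
    rw [cfLimit_eq hm, inv_inv, Int.floor_eq_iff]
    exact ⟨by linarith [hmem'.1], by linarith [hmem'.2]⟩
  induction i generalizing m with
  | zero => rw [partialQuotient_one hmem, hfl]
  | succ i ih =>
    have hfr : Int.fract (cfLimit m)⁻¹ = cfLimit fun i => m (i + 1) := by
      rw [← Int.self_sub_floor, hfl, cfLimit_eq hm, inv_inv]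
      ring
    have hm' : ∀ i, 1 ≤ m (i + 1) := fun i => hm _
    have h'' := cfLimit_mem_Ioo fun i => hm' (i + 1)
    rw [partialQuotient_add_two hmem, hfr]
    refine ih hm' hmem' h'' ?_
    rw [cfLimit_eq hm', inv_inv, Int.floor_eq_iff]
    exact ⟨by linarith [h''.1], by linarith [h''.2]⟩

theorem irrational_cfLimit {m : ℕ → ℤ} (hm : ∀ i, 1 ≤ m i) : Irrational (cfLimit m) :=
  irrational_of_partialQuotient_ne_zero fun i => by
    rw [partialQuotient_cfLimit hm]
    have := hm i
    omega

theorem inv_contFracValue_mem_Icc {l : List ℤ} (hl : ∀ a ∈ l, 1 ≤ a) :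
    (contFracValue l)⁻¹ ∈ Set.Icc (0 : ℝ) 1 := by
  induction l with
  | nil => simp [contFracValue]
  | cons a l ih =>
    exact inv_add_mem_Icc (hl a (by simp)) (ih fun b hb => hl b (by simp [hb])).1

theorem inv_contFracValue_append {m : ℕ → ℤ} {p : List ℤ}
    (hp : ∀ i (h : i < p.length), p[i] = m i) (s : List ℤ) :
    (contFracValue (p ++ s))⁻¹ = cfEval m p.length (contFracValue s)⁻¹ := by
  induction p generalizing m with
  | nil => rfl
  | cons a p ih =>
    rw [List.cons_append, contFracValue, List.length_cons, cfEval,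
      ih (m := fun i => m (i + 1)) fun i h => hp (i + 1) (Nat.succ_lt_succ h),
      ← hp 0 (by simp)]
    rfl

/-! ### Reduction of the words defining `jimm` -/

theorem reduceWord_ne_nil (m : ℤ) (w : List (ℤ × ℤ)) : reduceWord m w ≠ [] := by
  induction w generalizing m with
  | nil => simp [reduceWord]
  | cons x w ih =>
    obtain ⟨k, n⟩ := x
    rw [reduceWord]
    split_ifs
    · exact ih _
    · simp

theorem reduceWord_append_singleton {m a : ℤ} {w : List (ℤ × ℤ)} {p : List ℤ}
    (h : reduceWord m w = p ++ [a]) (k n : ℤ) :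
    reduceWord m (w ++ [(k, n)]) =
      if k = -1 then p ++ [a + n - 1] else p ++ a :: List.replicate k.toNat 1 ++ [n] := by
  induction w generalizing m p with
  | nil =>
    have h' : [] ++ [m] = p ++ [a] := h
    obtain ⟨rfl, h2⟩ := List.append_inj' h' rfl
    obtain rfl : m = a := by simpa using h2
    simp [reduceWord]
  | cons x w ih =>
    obtain ⟨k', n'⟩ := x
    rw [List.cons_append]
    rw [reduceWord] at h ⊢
    by_cases hk : k' = -1
    · rw [if_pos hk] at h ⊢
      exact ih h
    · rw [if_neg hk] at h ⊢
      obtain ⟨p', a', hp'⟩ : ∃ p' a', reduceWord n' w = p' ++ [a'] :=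
        ⟨_, _, (List.dropLast_append_getLast (reduceWord_ne_nil n' w)).symm⟩
      have h1 : (m :: (List.replicate k'.toNat 1 ++ p')) ++ [a'] = p ++ [a] := by
        rw [← h, hp']
        simp
      obtain ⟨rfl, h2⟩ := List.append_inj' h1 rfl
      obtain rfl : a' = a := by simpa using h2
      rw [ih hp']
      split_ifs <;> simp

/-- The reduction of `0, 1_{n 1 - 1}, 2, …, 1_{n (r + 1) - 2}, 2` is `0`, followed by the list
`(jimmStable n r).1`, whose letters are not affected when the word is prolonged, and by the last
letter `(jimmStable n r).2`. -/
def jimmStable (n : ℕ → ℤ) : ℕ → List ℤ × ℤ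
  | 0 => (List.replicate (n 1 - 1).toNat 1, 2)
  | r + 1 =>
    if n (r + 2) = 1 then ((jimmStable n r).1, (jimmStable n r).2 + 1)
    else ((jimmStable n r).1 ++ (jimmStable n r).2 :: List.replicate (n (r + 2) - 2).toNat 1, 2)

theorem jimmWord_succ {n : ℕ → ℤ} (hn : ∀ i, 1 ≤ n (i + 1)) (r : ℕ) :
    jimmWord n (r + 1) = 0 :: ((jimmStable n r).1 ++ [(jimmStable n r).2]) := by
  induction r with
  | zero =>
    have := hn 0
    rw [zero_add] at this
    simp [jimmWord, reduceWord, jimmStable]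
    omega
  | succ r ih =>
    rw [jimmWord, List.range_succ, List.map_append, List.map_singleton,
      reduceWord_append_singleton (p := 0 :: (jimmStable n r).1) (a := (jimmStable n r).2) ih,
      if_neg (Nat.succ_ne_zero r), jimmStable]
    by_cases h : n (r + 2) = 1
    · rw [if_pos (show n (r + 2) - 2 = -1 by omega), if_pos h]
      simp
      ring
    · have h1 : 1 ≤ n (r + 2) := hn (r + 1)
      rw [if_neg (show ¬n (r + 2) - 2 = -1 by omega), if_neg h]
      simp

theorem one_le_of_mem_jimmStable (n : ℕ → ℤ) (r : ℕ) :
    (∀ b ∈ (jimmStable n r).1, 1 ≤ b) ∧ 2 ≤ (jimmStable n r).2 := by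
  induction r with
  | zero => simp [jimmStable]
  | succ r ih =>
    rw [jimmStable]
    split_ifs
    · exact ⟨ih.1, by linarith [ih.2]⟩
    · refine ⟨fun b hb => ?_, le_rfl⟩
      simp only [List.mem_append, List.mem_cons, List.mem_replicate] at hb
      rcases hb with hb | rfl | ⟨-, rfl⟩
      · exact ih.1 b hb
      · linarith [ih.2]
      · exact le_rfl

theorem length_jimmStable {n : ℕ → ℤ} (hn : ∀ i, 1 ≤ n (i + 1)) (r : ℕ) :
    ((jimmStable n r).1.length : ℤ) = ∑ i ∈ Finset.range (r + 1), n (i + 1) - (r + 1) := by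
  induction r with
  | zero =>
    have := hn 0
    simp [jimmStable] at this ⊢
    omega
  | succ r ih =>
    have := hn (r + 1)
    rw [Finset.sum_range_succ, jimmStable]
    split_ifs with h
    · rw [ih, h]
      push_cast
      ring
    · simp only [List.length_append, List.length_cons, List.length_replicate]
      push_cast
      rw [ih]
      have : 1 + 1 ≤ n (r + 2) := Int.add_one_le_of_lt (lt_of_le_of_ne this (Ne.symm h))
      rw [show n (r + 1 + 1) = n (r + 2) from rfl]
      omega

theorem sum_jimmStable {n : ℕ → ℤ} (hn : ∀ i, 1 ≤ n (i + 1)) (r : ℕ) :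
    (jimmStable n r).1.sum + (jimmStable n r).2 = ∑ i ∈ Finset.range (r + 1), n (i + 1) + 1 := by
  induction r with
  | zero =>
    have := hn 0
    simp [jimmStable] at this ⊢
    omega
  | succ r ih =>
    have := hn (r + 1)
    rw [Finset.sum_range_succ, jimmStable]
    split_ifs with h
    · rw [show n (r + 1 + 1) = n (r + 2) from rfl, h]
      simp only
      omega
    · simp only [List.sum_append, List.sum_cons, List.sum_replicate, nsmul_eq_mul, mul_one]
      have : 1 + 1 ≤ n (r + 2) := Int.add_one_le_of_lt (lt_of_le_of_ne this (Ne.symm h))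
      rw [show n (r + 1 + 1) = n (r + 2) from rfl]
      omega

theorem jimmStable_prefix (n : ℕ → ℤ) {r r' : ℕ} (h : r ≤ r') :
    (jimmStable n r).1 <+: (jimmStable n r').1 := by
  induction r', h using Nat.le_induction with
  | base => exact List.prefix_rfl
  | succ r' _ ih =>
    refine ih.trans ?_
    rw [jimmStable]
    split_ifs
    · exact List.prefix_rfl
    · exact List.prefix_append _ _

theorem length_le_sum_of_one_le {l : List ℤ} (hl : ∀ a ∈ l, 1 ≤ a) : (l.length : ℤ) ≤ l.sum := by
  simpa using List.card_nsmul_le_sum l 1 hl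

theorem sum_range_le_of_jimmStable {n m : ℕ → ℤ} (hn : ∀ i, 1 ≤ n (i + 1)) {r : ℕ}
    (hm : ∀ i (h : i < (jimmStable n r).1.length), (jimmStable n r).1[i] = m i) {N : ℕ}
    (hN : N ≤ (jimmStable n r).1.length) :
    ∑ i ∈ Finset.range N, m i ≤ N + r := by
  set p := (jimmStable n r).1 with hp
  have h1 : ∑ i ∈ Finset.range N, m i = (p.take N).sum := by
    rw [Finset.sum_range, ← List.sum_ofFn]
    congr 1
    refine List.ext_getElem (by simp [hN]) fun i h _ => ?_
    simp only [List.length_ofFn] at h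
    simp [hm i (by omega)]
  have h2 : (p.take N).sum + (p.drop N).sum = p.sum := List.sum_take_add_sum_drop p N
  have h3 := length_le_sum_of_one_le (l := p.drop N) fun a ha =>
    (one_le_of_mem_jimmStable n r).1 a (List.mem_of_mem_drop ha)
  have h4 := sum_jimmStable hn r
  have h5 := length_jimmStable hn r
  have h6 := (one_le_of_mem_jimmStable n r).2
  rw [List.length_drop, Nat.cast_sub hN] at h3
  rw [← hp] at h4 h5
  omega

/-! ### Partial quotients of `jimm x` -/

theorem tendsto_average_of_sum_le {m : ℕ → ℤ} (hm : ∀ i, 1 ≤ m i) {T : ℕ → ℕ}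
    (hT : ∀ C : ℝ, ∀ᶠ r : ℕ in atTop, C * r ≤ T r)
    (h : ∀ r N : ℕ, N ≤ T r → ∑ i ∈ Finset.range N, m i ≤ N + r) :
    Tendsto (fun N : ℕ => (∑ i ∈ Finset.range N, (m i : ℝ)) / N) atTop (𝓝 1) := by
  refine tendsto_order.2 ⟨fun a ha => ?_, fun b hb => ?_⟩
  · filter_upwards [eventually_gt_atTop 0] with N hN
    have hN' : (0 : ℝ) < N := by exact_mod_cast hN
    refine ha.trans_le ((one_le_div hN').2 ?_)
    calc (N : ℝ) = ∑ i ∈ Finset.range N, (1 : ℝ) := by simp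
      _ ≤ _ := Finset.sum_le_sum fun i _ => by exact_mod_cast hm i
  · set ε := b - 1 with hε
    have hε0 : 0 < ε := by linarith
    have hr : Tendsto (fun N : ℕ => ⌊ε / 2 * N⌋₊) atTop atTop :=
      tendsto_nat_floor_atTop.comp
        (tendsto_natCast_atTop_atTop.const_mul_atTop (by positivity))
    -- With `r = ⌊ε N / 2⌋`, the bound `T r ≥ (4 / ε) r` makes `T r` exceed `N`, while `r` costs only
    -- `ε / 2` in the average.
    filter_upwards [hr.eventually (hT (4 / ε)), eventually_gt_atTop 0,
      tendsto_natCast_atTop_atTop.eventually_ge_atTop (4 / ε)] with N h1 h2 h3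
    have hN' : (0 : ℝ) < N := by exact_mod_cast h2
    have h4 := Nat.lt_floor_add_one (ε / 2 * N)
    have h5 := Nat.floor_le (show 0 ≤ ε / 2 * N by positivity)
    have h6 : (N : ℝ) ≤ T ⌊ε / 2 * N⌋₊ := by
      refine le_trans ?_ h1
      calc (N : ℝ) ≤ 2 * N - 4 / ε := by linarith
        _ = 4 / ε * (ε / 2 * N - 1) := by field_simp; ring
        _ ≤ _ := by gcongr; linarith
    have h7 : (∑ i ∈ Finset.range N, (m i : ℝ)) ≤ N + ⌊ε / 2 * N⌋₊ := by
      exact_mod_cast h _ N (by exact_mod_cast h6)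
    rw [div_lt_iff₀ hN']
    nlinarith

/-- The sequence `m` is formed by the stable letters of the reduced words, and the number `T r` of
stable letters after `r + 1` partial quotients grows faster than linearly. -/
theorem exists_jimm_eq_cfLimit {x : ℝ} (hx : x ∈ infiniteAverageSet) :
    ∃ m : ℕ → ℤ, (∀ i, 1 ≤ m i) ∧ jimm x = cfLimit m ∧
      Tendsto (fun N : ℕ => (∑ i ∈ Finset.range N, (m i : ℝ)) / N) atTop (𝓝 1) := by
  obtain ⟨hmem, hirr, hav⟩ := hx
  have hx' : x ∈ Set.Ioo (0 : ℝ) 1 :=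
    ⟨lt_of_le_of_ne hmem.1 hirr.ne_zero.symm, lt_of_le_of_ne hmem.2 hirr.ne_one⟩
  set n := partialQuotient x with hn_def
  have hn : ∀ i, 1 ≤ n (i + 1) := one_le_partialQuotient hirr hx'
  set T : ℕ → ℕ := fun r => (jimmStable n r).1.length with hT_def
  have hT : ∀ C : ℝ, ∀ᶠ r : ℕ in atTop, C * r ≤ T r := by
    intro C
    filter_upwards [((tendsto_add_atTop_iff_nat 1).2 hav).eventually_ge_atTop (max C 0 + 1)]
      with r hr
    have h1 : (T r : ℝ) = ∑ i ∈ Finset.range (r + 1), (n (i + 1) : ℝ) - (r + 1) := by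
      exact_mod_cast length_jimmStable hn r
    have h2 : ∑ i ∈ Finset.range (r + 1), (n (i + 1) : ℝ) =
        ∑ i ∈ Finset.Icc 1 (r + 1), (n i : ℝ) := by
      rw [Finset.range_eq_Ico, Finset.sum_Ico_add' (fun i => (n i : ℝ)) 0 (r + 1) 1, zero_add,
        Finset.Ico_add_one_right_eq_Icc]
    have hr0 : (0 : ℝ) < ((r + 1 : ℕ) : ℝ) := by positivity
    rw [partialQuotientAverage, le_div_iff₀ hr0, ← h2] at hr
    push_cast at hr
    have h3 := le_max_left C 0
    have h4 := le_max_right C 0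
    have h5 : (0 : ℝ) ≤ r := Nat.cast_nonneg r
    nlinarith
  have hTt : Tendsto T atTop atTop := by
    refine tendsto_atTop.2 fun b => ?_
    filter_upwards [hT 1, eventually_ge_atTop b] with r h1 h2
    have : r ≤ T r := by
      rw [one_mul] at h1
      exact_mod_cast h1
    omega
  choose R hR using fun i : ℕ => (hTt.eventually_gt_atTop i).exists
  set m : ℕ → ℤ := fun i => (jimmStable n (R i)).1[i]'(hR i) with hm_def
  have hm : ∀ r i (h : i < (jimmStable n r).1.length), (jimmStable n r).1[i] = m i := by
    intro r i h
    rcases le_total r (R i) with hr | hr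
    · exact (jimmStable_prefix n hr).getElem h
    · exact ((jimmStable_prefix n hr).getElem (hR i)).symm
  have hm1 : ∀ i, 1 ≤ m i := fun i =>
    (one_le_of_mem_jimmStable n (R i)).1 _ (List.getElem_mem _)
  refine ⟨m, hm1, ?_, tendsto_average_of_sum_le hm1 hT fun r N hN =>
    sum_range_le_of_jimmStable hn (hm r) hN⟩
  refine Tendsto.limUnder_eq ((tendsto_add_atTop_iff_nat 1).1 ?_)
  have hval : ∀ r, contFracValue (jimmWord n (r + 1)) =
      cfEval m (T r) (contFracValue [(jimmStable n r).2])⁻¹ := by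
    intro r
    rw [jimmWord_succ hn, contFracValue, inv_contFracValue_append (hm r), Int.cast_zero, zero_add]
  refine (tendsto_cfEval hm1 hTt fun r => inv_contFracValue_mem_Icc fun a ha => ?_).congr
    fun r => (hval r).symm
  rw [List.mem_singleton.1 ha]
  linarith [(one_le_of_mem_jimmStable n r).2]

/-- For positive integers `m`, the indicator of `m = 1` lies between `2 - m` and `1`. -/
theorem tendsto_onesProportion_of_average {y : ℝ} (hy : ∀ i, 1 ≤ partialQuotient y (i + 1))
    (h : Tendsto (partialQuotientAverage y) atTop (𝓝 1)) :
    Tendsto (onesProportion y) atTop (𝓝 1) := by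
  have h2 : Tendsto (fun k => 2 - partialQuotientAverage y k) atTop (𝓝 1) := by
    have := h.const_sub 2
    norm_num at this
    exact this
  refine tendsto_of_tendsto_of_tendsto_of_le_of_le' h2 tendsto_const_nhds ?_ ?_
  · filter_upwards [eventually_gt_atTop 0] with k hk
    have hk' : (0 : ℝ) < k := by exact_mod_cast hk
    rw [partialQuotientAverage, onesProportion, sub_le_iff_le_add, ← add_div, le_div_iff₀ hk',
      Finset.card_filter]
    push_cast
    rw [← Finset.sum_add_distrib]
    calc 2 * (k : ℝ) = ∑ i ∈ Finset.Icc 1 k, (2 : ℝ) := by simp [mul_comm]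
      _ ≤ _ := Finset.sum_le_sum fun i hi => by
        obtain ⟨i, rfl⟩ := Nat.exists_eq_succ_of_ne_zero
          (Nat.one_le_iff_ne_zero.1 (Finset.mem_Icc.1 hi).1)
        have h1 := hy i
        split_ifs with h3
        · rw [h3]; norm_num
        · have : (2 : ℤ) ≤ partialQuotient y (i + 1) :=
            Int.add_one_le_of_lt (lt_of_le_of_ne h1 (Ne.symm h3))
          have : (2 : ℝ) ≤ partialQuotient y (i + 1) := by exact_mod_cast this
          linarith
  · refine Eventually.of_forall fun k => div_le_one_of_le₀ ?_ (Nat.cast_nonneg k)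
    exact_mod_cast (Finset.card_filter_le _ _).trans (by simp)

theorem jimm_of_mem_infiniteAverageSet {x : ℝ} (hx : x ∈ infiniteAverageSet) :
    jimm x ∈ Set.Icc (0 : ℝ) 1 ∧ Irrational (jimm x) ∧
      Tendsto (onesProportion (jimm x)) atTop (𝓝 1) ∧
      Tendsto (partialQuotientAverage (jimm x)) atTop (𝓝 1) := by
  obtain ⟨m, hm, hj, hav⟩ := exists_jimm_eq_cfLimit hx
  have h : Tendsto (partialQuotientAverage (jimm x)) atTop (𝓝 1) := by
    refine hav.congr fun N => ?_
    rw [hj, partialQuotientAverage, ← Finset.Ico_add_one_right_eq_Icc, ← zero_add 1,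
      ← Finset.sum_Ico_add' (fun i => (partialQuotient (cfLimit m) i : ℝ)) 0 N 1,
      Finset.range_eq_Ico]
    simp only [partialQuotient_cfLimit hm]
  refine ⟨hj ▸ cfLimit_mem_Icc hm, hj ▸ irrational_cfLimit hm,
    tendsto_onesProportion_of_average (fun i => ?_) h, h⟩
  rw [hj, partialQuotient_cfLimit hm]
  exact hm i

/-! ### The probabilistic statement -/

theorem volume_Icc_diff_infiniteAverageSet :
    volume (Set.Icc (0 : ℝ) 1 \ infiniteAverageSet) = 0 := by
  have hirr : ∀ᵐ x : ℝ, Irrational x := (Set.countable_range ((↑) : ℚ → ℝ)).ae_notMem volume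
  have hav := (ae_restrict_iff' measurableSet_Ioc).1 ae_tendsto_partialQuotientAverage
  have : ∀ᵐ x : ℝ, x ∉ Set.Icc (0 : ℝ) 1 \ infiniteAverageSet := by
    filter_upwards [hirr, hav] with x hx h
    rintro ⟨hmem, hn⟩
    exact hn ⟨hmem, hx, h ⟨lt_of_le_of_ne hmem.1 hx.ne_zero.symm, hmem.2⟩⟩
  exact measure_eq_zero_iff_ae_notMem.2 this

theorem lemma1 :
    (∀ {Ω : Type*} [MeasurableSpace Ω] (P : Measure Ω) [IsProbabilityMeasure P] (X : Ω → ℝ),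
      pdf.IsUniform X (Set.Icc (0 : ℝ) 1) P volume →
        (∀ᵐ ω ∂P, Irrational (jimm (X ω)) ∧
          Tendsto (onesProportion (jimm (X ω))) atTop (𝓝 1)) ∧
        (∀ᵐ ω ∂P, Tendsto (partialQuotientAverage (jimm (X ω))) atTop (𝓝 1))) ∧
    volume (Set.Icc (0 : ℝ) 1 \ infiniteAverageSet) = 0 ∧
    volume (jimm '' infiniteAverageSet) = 0 := by
  refine ⟨fun P _ X hX => ?_, volume_Icc_diff_infiniteAverageSet, ?_⟩
  · have h1 : ∀ᵐ x ∂ProbabilityTheory.cond volume (Set.Icc (0 : ℝ) 1), x ∈ infiniteAverageSet := by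
      have h2 : ∀ᵐ x ∂ProbabilityTheory.cond volume (Set.Icc (0 : ℝ) 1),
          x ∉ Set.Icc (0 : ℝ) 1 \ infiniteAverageSet :=
        ProbabilityTheory.cond_absolutelyContinuous
          (measure_eq_zero_iff_ae_notMem.1 volume_Icc_diff_infiniteAverageSet)
      filter_upwards [h2, ProbabilityTheory.ae_cond_mem measurableSet_Icc] with x hx hmem
      exact not_not.1 fun hn => hx ⟨hmem, hn⟩
    have hXm : AEMeasurable X P := hX.aemeasurable (by simp) (by simp)
    have h3 : ∀ᵐ ω ∂P, X ω ∈ infiniteAverageSet := by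
      refine ae_of_ae_map hXm ?_
      rw [show P.map X = _ from hX]
      exact h1
    constructor
    · filter_upwards [h3] with ω hω
      exact ⟨(jimm_of_mem_infiniteAverageSet hω).2.1, (jimm_of_mem_infiniteAverageSet hω).2.2.1⟩
    · filter_upwards [h3] with ω hω
      exact (jimm_of_mem_infiniteAverageSet hω).2.2.2
  · refine measure_mono_null ?_ volume_Icc_diff_infiniteAverageSet
    rintro _ ⟨x, hx, rfl⟩
    obtain ⟨hmem, -, -, hav⟩ := jimm_of_mem_infiniteAverageSet hx
    exact ⟨hmem, fun h => not_tendsto_nhds_of_tendsto_atTop h.2.2 1 hav⟩
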